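/- Let $n\ge 2$ and $m\ge 1$ be integers. Write $\mathcal{M}_k$ for the ring of complex $k\times k$ matrices, $\operatorname{Herm}_k\subset\mathcal{M}_k$ for the set of Hermitian ones, $\operatorname{spec}(A)$ for the set of eigenvalues of $A$ (ignoring multiplicities), $\bar M$ for the entrywise complex conjugate of $M$, and $M^{\oplus p}:=\bigoplus_{i=1}^p M$. For any map $\mathcal{E}:\operatorname{Herm}_n\to\operatorname{Herm}_m$, the following are equivalent: 1. For all $A,B\in\operatorname{Herm}_n$ and all $p\in[0,1]$: $\mathcal{E}(A)=\mathcal{E}(A)^\dagger$; $\operatorname{spec}(\mathcal{E}(A))=\operatorname{spec}(A)$; and $\mathcal{E}(pA+(1-p)B)=p\,\mathcal{E}(A)+(1-p)\,\mathcal{E}(B)$. 2. There exists a unique map $\mathcal{E}':\mathcal{M}_n\to\mathcal{M}_m$ such that $\mathcal{E}'(H)=\mathcal{E}(H)$ for all $H\in\operatorname{Herm}_n$ and, for all $A,B\in\mathcal{M}_n$ and $x\in\mathbb{R}$: $\mathcal{E}'(\mathbb{1})=\mathbb{1}$, $\mathcal{E}'(A^\dagger)=\mathcal{E}'(A)^\dagger$,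 $\mathcal{E}'(A+B)=\mathcal{E}'(A)+\mathcal{E}'(B)$, $\mathcal{E}'(AB)=\mathcal{E}'(A)\mathcal{E}'(B)$ and $\mathcal{E}'(xA)=x\,\mathcal{E}'(A)$. 3. There exists a unique map $\mathcal{E}':\mathcal{M}_n\to\mathcal{M}_m$ such that $\mathcal{E}'(H)=\mathcal{E}(H)$ for all $H\in\operatorname{Herm}_n$ and $\mathcal{E}'$ is of the form $$\mathcal{E}'(M)=U\left(M^{\oplus p}\oplus\bar M^{\oplus q}\right)U^\dagger\qquad(M\in\mathcal{M}_n)$$ for some non-negative integers $p,q$ (with $(p+q)n=m$) and some unitary $U\in\mathcal{M}_m$. -/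

import Mathlib

open scoped Matrix

namespace HamiltonianEncoding

/-- `𝓜 n`: all `n × n` complex matrices. -/
abbrev Mat (n : ℕ) : Type := Matrix (Fin n) (Fin n) ℂ

/-- `Herm n`: the real vector space of all `n × n` complex Hermitian matrices. -/
abbrev Herm (n : ℕ) : Type := selfAdjoint (Mat n)

/-- Entrywise complex conjugate of a matrix. -/
def conjMat {n : ℕ} (M : Mat n) : Mat n := M.map (starRingEnd ℂ)

/-- `M^{⊕ p}`: the block-diagonal matrix with `p` consecutive diagonal blocks equal to `M`. -/
def copies {n : ℕ} (p : ℕ) (M : Mat n) : Mat (p * n) :=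
  Matrix.reindex ((Equiv.prodComm (Fin n) (Fin p)).trans finProdFinEquiv)
    ((Equiv.prodComm (Fin n) (Fin p)).trans finProdFinEquiv)
    (Matrix.blockDiagonal fun _ : Fin p => M)

/-- `A ⊕ B`: the block-diagonal matrix with diagonal blocks `A` and `B`, in this order. -/
def directSum {a b : ℕ} (A : Mat a) (B : Mat b) : Mat (a + b) :=
  Matrix.reindex finSumFinEquiv finSumFinEquiv (Matrix.fromBlocks A 0 0 B)

/-- `E` preserves Hermiticity and the spectrum, and is convex-linear. -/
def IsOperational {n m : ℕ} (E : Herm n → Herm m) : Prop :=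
  ∀ A B : Herm n, ∀ p ∈ Set.Icc (0 : ℝ) 1,
    ((E A : Mat m) = (E A : Mat m)ᴴ) ∧
    spectrum ℂ (E A : Mat m) = spectrum ℂ (A : Mat n) ∧
    E (p • A + (1 - p) • B) = p • E A + (1 - p) • E B

/-- The map `E'` on all matrices restricts to `E` on the Hermitian ones. -/
def Extends {n m : ℕ} (E' : Mat n → Mat m) (E : Herm n → Herm m) : Prop :=
  ∀ H : Herm n, E' (H : Mat n) = (E H : Mat m)

/-- `E'` is a unital, `†`-preserving, real-linear ring homomorphism. -/
def IsRealStarHom {n m : ℕ} (E' : Mat n → Mat m) : Prop :=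
  E' 1 = 1 ∧
  (∀ A : Mat n, E' Aᴴ = (E' A)ᴴ) ∧
  (∀ A B : Mat n, E' (A + B) = E' A + E' B) ∧
  (∀ A B : Mat n, E' (A * B) = E' A * E' B) ∧
  (∀ (x : ℝ) (A : Mat n), E' (x • A) = x • E' A)

/-- `E' M = U (M^{⊕ p} ⊕ M̄^{⊕ q}) U†` for all `M`, for some `p, q ≥ 0` and some unitary `U` of
size `m`. The equation `p * n + q * n = m` expresses that both sides have the same size, and
`finCongr` only casts along it. -/
def HasCanonicalForm {n m : ℕ} (E' : Mat n → Mat m) : Prop :=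
  ∃ (p q : ℕ) (h : p * n + q * n = m), ∃ U ∈ Matrix.unitaryGroup (Fin m) ℂ,
    ∀ M : Mat n, E' M =
      U * Matrix.reindex (finCongr h) (finCongr h)
        (directSum (copies p M) (copies q (conjMat M))) * Uᴴ

end HamiltonianEncoding

/-!
The hard implication is that an operational map `E` is canonical; the other two are bookkeeping
around the fact that a canonical form is a real `*`-homomorphism.

Since `E 0 = 0`, convex-linearity makes `E` real-linear, and spectrum preservation makes it send
projections to projections. If two orthogonal projections have images `P` and `Q`, then `P + Q` is
again a projection, so `P` and `Q` are orthogonal. Diagonalizing `A`, it follows that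
`E (A ^ 2) = E A ^ 2`, and the complex-linear extension `F` of `E` to all matrices satisfies
`F (M ^ 2) = F M ^ 2`: it is a Jordan homomorphism (`map_mul_self_of_isHermitian`,
`map_mul_self_of_isSelfAdjoint`).

The images `x i j` of the matrix units under a Jordan `*`-homomorphism split into a homomorphic and
an anti-homomorphic part. Only the first column of each part is needed: fix an index `o`; the
elements `a i = x i i * x i o` and `b i = x i i * x o i`, completed at `i = o` by two orthogonal
projections with sum `x o o`, are mutually orthogonal systems of partial isometries with
`x i j = a i * star (a j) + b j * star (b i)`
(`JordanMatrixUnits.isMatrixUnitColumn`, `JordanMatrixUnits.star_column_mul_flip_column`,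
`JordanMatrixUnits.eq_column_add_flip_column`). On a Hermitian matrix `H`, replacing `H i j` by the
conjugate of `H j i` turns the second part into a homomorphism of the entrywise conjugate of `H`.
Orthonormal bases of the ranges of `a o` and `b o`, carried along by the `a i` and the `b i`, are
the columns of the unitary in the canonical form
(`HamiltonianEncoding.hasCanonicalForm_of_isometries`).

Uniqueness holds because for `n ≥ 2` the Hermitian matrices generate the ring of all matrices
(`HamiltonianEncoding.subring_eq_top_of_selfAdjoint_le`). A real `*`-homomorphism preserves the
spectrum of Hermitian matrices because it is injective, the matrix ring being simple, and because
an injective homomorphism out of an Artinian ring reflects units.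
-/

open scoped ComplexStarModule

/-! ### Images of matrix units under a Jordan homomorphism -/

/-- A family with the Jordan products `x i j ∘ x k l` and the adjoints of a system of matrix units,
such as the image of the matrix units under a Jordan `*`-homomorphism. The family need not be
unital. -/
structure JordanMatrixUnits {ι R : Type*} [DecidableEq ι] [Ring R] [StarRing R]
    (x : ι → ι → R) : Prop where
  jordan : ∀ i j k l, x i j * x k l + x k l * x i j =
    (if j = k then x i l else 0) + (if l = i then x k j else 0)
  star_eq : ∀ i j, star (x i j) = x j i

namespace JordanMatrixUnits

variable {ι R : Type*} [DecidableEq ι] [Ring R] [StarRing R] {x : ι → ι → R}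

lemma diag_mul_self [IsAddTorsionFree R] (hx : JordanMatrixUnits x) (i : ι) :
    x i i * x i i = x i i := by
  have h := hx.jordan i i i i
  simp only [if_true, ← two_nsmul] at h
  exact nsmul_right_injective two_ne_zero h

lemma diag_mul_of_ne [IsAddTorsionFree R] (hx : JordanMatrixUnits x) {i j k : ι} (hi : k ≠ i)
    (hj : k ≠ j) : x k k * x i j = 0 := by
  have h := hx.jordan k k i j
  rw [if_neg hi, if_neg hj.symm, add_zero] at h
  exact IsIdempotentElem.mul_eq_zero_of_anticommute (hx.diag_mul_self k) h

lemma mul_self_of_ne [IsAddTorsionFree R] (hx : JordanMatrixUnits x) {i j : ι} (h : i ≠ j) :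
    x i j * x i j = 0 := by
  have h1 := hx.jordan i j i j
  rw [if_neg h.symm, add_zero, ← two_nsmul] at h1
  exact nsmul_right_injective two_ne_zero (h1.trans (smul_zero 2).symm)

lemma diag_mul_add_left (hx : JordanMatrixUnits x) {i j : ι} (h : i ≠ j) :
    x i i * x i j + x i j * x i i = x i j := by
  have h1 := hx.jordan i i i j
  rwa [if_pos rfl, if_neg h.symm, add_zero] at h1

lemma diag_mul_add_right (hx : JordanMatrixUnits x) {i j : ι} (h : i ≠ j) :
    x j j * x i j + x i j * x j j = x i j := by
  have h1 := hx.jordan j j i j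
  rwa [if_neg h.symm, if_pos rfl, zero_add] at h1

/-- Together with `diag_mul_right`, this is the Peirce decomposition of `x i j` into its corner from
`j` to `i` and its corner from `i` to `j`. -/
lemma diag_mul_left [IsAddTorsionFree R] (hx : JordanMatrixUnits x) {i j : ι} (h : i ≠ j) :
    x i i * x i j = x i j * x j j := by
  have h1 : x i i * x i j = x i i * x i j * x j j := by
    nth_rewrite 1 [← hx.diag_mul_add_right h]
    rw [mul_add, ← mul_assoc, hx.diag_mul_of_ne h h, zero_mul, zero_add, mul_assoc]
  have h2 : x i j * x j j = x i i * x i j * x j j := by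
    nth_rewrite 1 [← hx.diag_mul_add_left h]
    rw [add_mul, mul_assoc (x i j), hx.diag_mul_of_ne h h, mul_zero, add_zero]
  rw [h1, ← h2]

lemma diag_mul_right [IsAddTorsionFree R] (hx : JordanMatrixUnits x) {i j : ι} (h : i ≠ j) :
    x j j * x i j = x i j * x i i := by
  have h1 := hx.diag_mul_add_right h
  have h2 := hx.diag_mul_add_left h
  rw [hx.diag_mul_left h, add_comm] at h2
  exact add_right_cancel (h1.trans h2.symm)

/-- Transposing the indices exchanges the homomorphic and the anti-homomorphic part. -/
lemma flip (hx : JordanMatrixUnits x) : JordanMatrixUnits fun i j => x j i where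
  jordan i j k l := by
    rw [hx.jordan j i l k, add_comm]
    congr 1
    · simp only [eq_comm]
    · simp only [eq_comm]
  star_eq i j := hx.star_eq j i

/-- The projection `x o o` is the sum of the initial projections of `x i i * x i o` and
`x i i * x o i`, the homomorphic and the anti-homomorphic corner. -/
lemma base_add_flip_base [IsAddTorsionFree R] (hx : JordanMatrixUnits x) {o i : ι} (h : i ≠ o) :
    x o i * x i i * x i o + x i o * x i i * x o i = x o o := by
  rw [← hx.diag_mul_left h.symm, ← hx.diag_mul_right h, mul_assoc, mul_assoc, ← mul_add,
    hx.jordan o i i o, if_pos rfl, if_pos rfl, mul_add, hx.diag_mul_self,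
    hx.diag_mul_of_ne h.symm h.symm, add_zero]

/-- The homomorphic and anti-homomorphic initial projections are orthogonal even when they are read
off from different indices; this is why they do not depend on the index. -/
lemma base_mul_flip_base [IsAddTorsionFree R] (hx : JordanMatrixUnits x) {o i k : ι} (hi : i ≠ o)
    (hk : k ≠ o) : x o i * x i i * x i o * (x k o * x k k * x o k) = 0 := by
  by_cases hik : i = k
  · subst hik
    calc _ = x o i * x i i * (x i o * x i o) * (x i i * x o i) := by simp only [mul_assoc]
      _ = 0 := by rw [hx.mul_self_of_ne hi]; simp
  · have h := hx.jordan i o k o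
    rw [if_neg hk.symm, if_neg hi.symm, add_zero] at h
    calc _ = x o i * x i i * (x i o * x k o) * (x k k * x o k) := by simp only [mul_assoc]
      _ = x o i * (x i i * x k o) * x i o * (x k k * x o k) * (-1) := by
        rw [eq_neg_of_add_eq_zero_left h]; simp [mul_assoc]
      _ = 0 := by rw [hx.diag_mul_of_ne hik hi]; simp

lemma star_base (hx : JordanMatrixUnits x) (o i : ι) :
    star (x o i * x i i * x i o) = x o i * x i i * x i o := by
  simp [hx.star_eq, mul_assoc]

lemma diag_mul_base [IsAddTorsionFree R] (hx : JordanMatrixUnits x) {o i : ι} (h : i ≠ o) :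
    x o o * (x o i * x i i * x i o) = x o i * x i i * x i o := by
  rw [← hx.diag_mul_left h.symm, mul_assoc, ← mul_assoc, hx.diag_mul_self]

lemma base_mul_base [IsAddTorsionFree R] (hx : JordanMatrixUnits x) {o i k : ι} (hi : i ≠ o)
    (hk : k ≠ o) :
    x o i * x i i * x i o * (x o k * x k k * x k o) = x o i * x i i * x i o := by
  have h := congrArg (x o i * x i i * x i o * ·) (hx.base_add_flip_base hk)
  simp only [mul_add, hx.base_mul_flip_base hi hk, add_zero] at h
  rw [h]
  simpa [hx.star_eq, mul_assoc] using congrArg star (hx.diag_mul_base hi)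

lemma base_eq [IsAddTorsionFree R] (hx : JordanMatrixUnits x) {o i k : ι} (hi : i ≠ o)
    (hk : k ≠ o) : x o i * x i i * x i o = x o k * x k k * x k o := by
  have h := congrArg star (hx.base_mul_base hi hk)
  rw [star_mul, hx.star_base, hx.star_base, hx.base_mul_base hk hi] at h
  exact h.symm

end JordanMatrixUnits

/-- The first column, indexed by `o`, of a system of matrix units: partial isometries `a i` with
the common initial projection `a o` and with mutually orthogonal ranges. The whole system is
recovered as `a i * star (a j)`. -/
structure IsMatrixUnitColumn {ι R : Type*} [DecidableEq ι] [Ring R] [StarRing R]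
    (o : ι) (a : ι → R) : Prop where
  star_mul_eq : ∀ i j, star (a i) * a j = if i = j then a o else 0
  mul_base : ∀ i, a i * a o = a i

namespace JordanMatrixUnits

section Column

variable {ι R : Type*} [DecidableEq ι] [Ring R]

/-- The column at `o` of the homomorphic part of a family of Jordan matrix units. The entry at `o`
itself is the initial projection of `x k k * x k o`; it does not depend on the auxiliary index
`k ≠ o`, by `JordanMatrixUnits.base_eq`. Applied to the transposed family, this gives the column of
the anti-homomorphic part. -/
def column (x : ι → ι → R) (o k : ι) (i : ι) : R :=
  if i = o then x o k * x k k * x k o else x i i * x i o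

lemma column_base (x : ι → ι → R) (o k : ι) : column x o k o = x o k * x k k * x k o := if_pos rfl

lemma column_of_ne (x : ι → ι → R) {o i : ι} (k : ι) (h : i ≠ o) :
    column x o k i = x i i * x i o := if_neg h

end Column

variable {ι R : Type*} [DecidableEq ι] [Ring R] [StarRing R] {x : ι → ι → R}

lemma star_column_base (hx : JordanMatrixUnits x) (o k : ι) :
    star (column x o k o) = column x o k o := by
  rw [column_base, hx.star_base]

lemma diag_mul_column [IsAddTorsionFree R] (hx : JordanMatrixUnits x) {o k : ι} (hk : k ≠ o)
    (i : ι) : x i i * column x o k i = column x o k i := by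
  by_cases h : i = o
  · subst h
    rw [column_base, hx.diag_mul_base hk]
  · rw [column_of_ne x k h, ← mul_assoc, hx.diag_mul_self]

lemma diag_mul_diag [IsAddTorsionFree R] (hx : JordanMatrixUnits x) {i j : ι} (h : i ≠ j) :
    x i i * x j j = 0 := hx.diag_mul_of_ne h h

lemma star_column_mul_of_ne [IsAddTorsionFree R] (hx : JordanMatrixUnits x) {o k i j : ι}
    (hk : k ≠ o) (hij : i ≠ j) {b : R} (hb : x j j * b = b) : star (column x o k i) * b = 0 := by
  rw [← hb, ← hx.diag_mul_column hk i, star_mul, hx.star_eq, mul_assoc, ← mul_assoc (x i i),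
    hx.diag_mul_diag hij, zero_mul, mul_zero]

lemma isMatrixUnitColumn [IsAddTorsionFree R] (hx : JordanMatrixUnits x) {o k : ι} (hk : k ≠ o) :
    IsMatrixUnitColumn o (column x o k) where
  star_mul_eq i j := by
    split_ifs with hij
    · subst hij
      by_cases h : i = o
      · subst h
        rw [hx.star_column_base, column_base, hx.base_mul_base hk hk]
      · rw [column_of_ne x k h, column_base, ← hx.base_eq h hk, star_mul, hx.star_eq, hx.star_eq,
          mul_assoc, ← mul_assoc (x i i), hx.diag_mul_self, mul_assoc]
    · exact hx.star_column_mul_of_ne hk hij (hx.diag_mul_column hk j)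
  mul_base i := by
    by_cases h : i = o
    · subst h
      rw [column_base, hx.base_mul_base hk hk]
    · have h1 := congrArg (x i i * x i o * ·) (hx.base_add_flip_base h)
      have h2 : x i i * x i o * (x i o * x i i * x o i) = 0 := by
        rw [mul_assoc, mul_assoc (x i o) (x i i), ← mul_assoc (x i o), hx.mul_self_of_ne h,
          zero_mul, mul_zero]
      simp only [mul_add, h2, add_zero] at h1
      rw [column_base, column_of_ne x k h, hx.base_eq hk h, h1, hx.diag_mul_left h, mul_assoc,
        hx.diag_mul_self]

lemma star_column_mul_flip_column [IsAddTorsionFree R] (hx : JordanMatrixUnits x) {o k : ι}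
    (hk : k ≠ o) (i j : ι) : star (column x o k i) * column (fun i j => x j i) o k j = 0 := by
  by_cases hij : i = j
  · subst hij
    by_cases h : i = o
    · subst h
      rw [hx.star_column_base, column_base, column_base, hx.base_mul_flip_base hk hk]
    · rw [column_of_ne x k h, column_of_ne _ k h, star_mul, hx.star_eq, hx.star_eq,
        hx.diag_mul_right (Ne.symm h), mul_assoc, ← mul_assoc (x i i),
        hx.diag_mul_right (Ne.symm h), ← mul_assoc, ← mul_assoc,
        hx.mul_self_of_ne (Ne.symm h), zero_mul, zero_mul]
  · exact hx.star_column_mul_of_ne hk hij (hx.flip.diag_mul_column hk j)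

/-- A family of Jordan matrix units is the sum of a system of matrix units and of the transpose of
another one. -/
lemma eq_column_add_flip_column [IsAddTorsionFree R] (hx : JordanMatrixUnits x) {o k : ι}
    (hk : k ≠ o) (i j : ι) :
    x i j = column x o k i * star (column x o k j) +
      column (fun i j => x j i) o k j * star (column (fun i j => x j i) o k i) := by
  -- The case `j = o`; the case `i = o` follows by taking adjoints.
  have key : ∀ i, i ≠ o → x i o = column x o k i * star (column x o k o) +
      column (fun i j => x j i) o k o * star (column (fun i j => x j i) o k i) := by
    intro i hi
    have hb := (hx.flip.isMatrixUnitColumn hk).mul_base i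
    have hb' := congrArg star hb
    rw [star_mul, hx.flip.star_column_base] at hb'
    rw [hx.star_column_base, (hx.isMatrixUnitColumn hk).mul_base, hb', column_of_ne x k hi,
      column_of_ne _ k hi, star_mul, hx.star_eq, hx.star_eq, hx.diag_mul_add_left hi]
  by_cases hi : i = o
  · by_cases hj : j = o
    · subst hi hj
      rw [hx.star_column_base, hx.flip.star_column_base, (hx.isMatrixUnitColumn hk).mul_base,
        (hx.flip.isMatrixUnitColumn hk).mul_base, column_base, column_base,
        hx.base_add_flip_base hk]
    · subst hi
      have h := congrArg star (key j hj)
      simpa [hx.star_eq] using h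
  · by_cases hj : j = o
    · subst hj
      exact key i hi
    · rw [column_of_ne x k hi, column_of_ne x k hj, column_of_ne _ k hi, column_of_ne _ k hj]
      simp only [star_mul, hx.star_eq]
      have h := hx.jordan i o o j
      rw [if_pos rfl] at h
      by_cases hij : i = j
      · subst hij
        have h1 : x i i * x i o * (x o i * x i i) + x i i * x o i * (x i o * x i i) =
            x i i * (x i o * x o i + x o i * x i o) * x i i := by noncomm_ring
        rw [h1, h, if_pos rfl, mul_add, hx.diag_mul_diag hi, add_zero, hx.diag_mul_self,
          hx.diag_mul_self]
      · -- The subtracted terms vanish, as `x i i * x o j` and `x j j * x i o` do.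
        have h1 : x i i * x i o * (x o j * x j j) + x j j * x o j * (x i o * x i i) =
            x i i * (x i o * x o j + x o j * x i o) * x j j +
              x j j * (x i o * x o j + x o j * x i o) * x i i -
              (x i i * x o j * x i o * x j j + x j j * x i o * x o j * x i i) := by
          noncomm_ring
        rw [h1, h, if_neg (Ne.symm hij), add_zero, hx.diag_mul_of_ne hi hij,
          hx.diag_mul_of_ne (Ne.symm hij) hj, hx.diag_mul_left hij,
          hx.diag_mul_right hij, mul_assoc, mul_assoc, hx.diag_mul_self, hx.diag_mul_self]
        simpa [hx.diag_mul_left hij, add_comm] using (hx.diag_mul_add_left hij).symm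

end JordanMatrixUnits

/-! ### From self-adjoint elements to Jordan homomorphisms -/

lemma map_linear_of_map_convexCombination {V W : Type*} [AddCommGroup V] [Module ℝ V]
    [AddCommGroup W] [Module ℝ W] {f : V → W} (h0 : f 0 = 0)
    (hf : ∀ A B : V, ∀ p ∈ Set.Icc (0 : ℝ) 1, f (p • A + (1 - p) • B) = p • f A + (1 - p) • f B) :
    IsLinearMap ℝ f := by
  have hs : ∀ t ∈ Set.Icc (0 : ℝ) 1, ∀ A, f (t • A) = t • f A := fun t ht A => by
    simpa [h0] using hf A 0 t ht
  have hadd : ∀ A B, f (A + B) = f A + f B := fun A B => by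
    have h1 := hf A B 2⁻¹ (by norm_num)
    have h2 : (1 - 2⁻¹ : ℝ) = 2⁻¹ := by norm_num
    rw [h2, ← smul_add, ← smul_add, hs _ (by norm_num)] at h1
    exact smul_right_injective W (by norm_num : (2⁻¹ : ℝ) ≠ 0) h1
  have hneg : ∀ A, f (-A) = -f A := fun A => by
    rw [eq_neg_iff_add_eq_zero, ← hadd, neg_add_cancel, h0]
  have hpos : ∀ t : ℝ, 0 ≤ t → ∀ A, f (t • A) = t • f A := fun t ht A => by
    rcases le_total t 1 with h | h
    · exact hs t ⟨ht, h⟩ A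
    · have ht' : t ≠ 0 := by positivity
      have h1 := hs t⁻¹ ⟨by positivity, inv_le_one_of_one_le₀ h⟩ (t • A)
      rw [inv_smul_smul₀ ht'] at h1
      rw [h1, smul_inv_smul₀ ht']
  refine ⟨hadd, fun t A => ?_⟩
  rcases le_total 0 t with h | h
  · exact hpos t h A
  · have h1 := hpos (-t) (neg_nonneg.2 h) A
    rw [neg_smul, neg_smul, hneg] at h1
    exact neg_injective h1

/-- The complex-linear extension of a real-linear map between the self-adjoint parts. -/
noncomputable def complexify {A B : Type*} [AddCommGroup A] [Module ℂ A] [StarAddMonoid A]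
    [StarModule ℂ A] [AddCommGroup B] [Module ℂ B] [StarAddMonoid B] [StarModule ℂ B]
    (L : selfAdjoint A →ₗ[ℝ] selfAdjoint B) : A →ₗ[ℂ] B where
  toFun M := (L (ℜ M) : B) + Complex.I • (L (ℑ M) : B)
  map_add' M N := by
    simp only [map_add, AddSubgroup.coe_add, smul_add]; abel
  map_smul' z M := by
    simp only [realPart_smul, imaginaryPart_smul, map_sub, map_add, map_smul, AddSubgroup.coe_add,
      AddSubgroup.coe_sub, selfAdjoint.val_smul, RingHom.id_apply, smul_add, smul_smul]
    conv_rhs => rw [← Complex.re_add_im z]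
    simp only [add_smul, add_mul, mul_smul, Complex.coe_smul]
    rw [smul_comm Complex.I z.re, smul_comm Complex.I z.im, smul_smul Complex.I Complex.I,
      Complex.I_mul_I]
    simp only [neg_smul, one_smul, smul_neg]
    abel

section
variable {A B : Type*} [AddCommGroup A] [Module ℂ A] [StarAddMonoid A]
    [StarModule ℂ A] [AddCommGroup B] [Module ℂ B] [StarAddMonoid B] [StarModule ℂ B]
    (L : selfAdjoint A →ₗ[ℝ] selfAdjoint B)

lemma complexify_apply (M : A) :
    complexify L M = (L (ℜ M) : B) + Complex.I • (L (ℑ M) : B) := rfl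

lemma complexify_coe (H : selfAdjoint A) : complexify L H = L H := by
  simp [complexify_apply]

lemma complexify_star (M : A) : complexify L (star M) = star (complexify L M) := by
  conv_lhs => rw [← realPart_add_I_smul_imaginaryPart M]
  rw [complexify_apply L M]
  simp [complexify_coe, selfAdjoint.star_val_eq]
end

lemma map_mul_self_sum_of_idempotent {ι R : Type*} [Fintype ι] [DecidableEq ι] [Ring R]
    [Algebra ℂ R] {e : ι → R} (he : ∀ i j, e i * e j = if i = j then e i else 0) (d : ι → ℂ) :
    (∑ i, d i • e i) * (∑ i, d i • e i) = ∑ i, (d i * d i) • e i := by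
  rw [Finset.sum_mul_sum]
  simp [he, mul_smul]

lemma Matrix.IsHermitian.eq_smul_one {m : ℕ} {B : Matrix (Fin m) (Fin m) ℂ} (hB : B.IsHermitian)
    {c : ℝ} (h : spectrum ℂ B ⊆ {(c : ℂ)}) : B = (c : ℂ) • 1 := by
  have he : (RCLike.ofReal ∘ hB.eigenvalues : Fin m → ℂ) = fun _ => (c : ℂ) := by
    funext i
    refine h ?_
    rw [hB.spectrum_eq_image_range]
    exact ⟨_, ⟨i, rfl⟩, rfl⟩
  rw [hB.spectral_theorem, he, ← Matrix.smul_one_eq_diagonal, map_smul, map_one]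

section Jordan
variable {n m : ℕ} {F : Matrix (Fin n) (Fin n) ℂ →ₗ[ℂ] Matrix (Fin m) (Fin m) ℂ}

/-- A linear map that sends projections to idempotents respects squares of Hermitian matrices. -/
lemma map_mul_self_of_isHermitian
    (hF : ∀ P : Matrix (Fin n) (Fin n) ℂ, IsStarProjection P → IsIdempotentElem (F P))
    {A : Matrix (Fin n) (Fin n) ℂ} (hA : A.IsHermitian) : F (A * A) = F A * F A := by
  have : IsAddTorsionFree (Matrix (Fin m) (Fin m) ℂ) := .of_module_rat _
  set σ := Unitary.conjStarAlgAut ℂ _ hA.eigenvectorUnitary with hσ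
  -- `e i` is the image of the `i`-th spectral projection of `A`.
  set e : Fin n → Matrix (Fin m) (Fin m) ℂ :=
    fun i => F (σ (Matrix.diagonal (Pi.single i 1))) with he
  have hsum : ∀ d : Fin n → ℂ, F (σ (Matrix.diagonal d)) = ∑ i, d i • e i := fun d => by
    have : Matrix.diagonal d = ∑ i, d i • Matrix.diagonal (Pi.single i (1 : ℂ)) := by
      simp_rw [Matrix.diagonal_single, Matrix.smul_single, smul_eq_mul, mul_one,
        Matrix.sum_single_eq_diagonal]
    rw [this]
    simp [he]
  have hproj : ∀ d : Fin n → ℂ, IsStarProjection d → IsIdempotentElem (F (σ (Matrix.diagonal d))) :=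
    fun d hd => by
      refine hF _ ⟨?_, ?_⟩
      · rw [IsIdempotentElem, ← map_mul, Matrix.diagonal_mul_diagonal']
        exact congrArg _ (congrArg _ hd.1)
      · rw [IsSelfAdjoint, ← map_star, Matrix.star_eq_conjTranspose, Matrix.diagonal_conjTranspose,
          hd.2.star_eq]
  have hself : ∀ i, IsStarProjection (Pi.single i 1 : Fin n → ℂ) := fun i => by
    refine ⟨?_, ?_⟩
    · rw [IsIdempotentElem, ← Pi.single_mul, mul_one]
    · rw [IsSelfAdjoint, ← Pi.single_star, star_one]
  have hidem : ∀ i j, e i * e j = if i = j then e i else 0 := by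
    intro i j
    split_ifs with hij
    · subst hij
      exact hproj _ (hself i)
    · -- `e i + e j` is idempotent as well, so the idempotents `e i` and `e j` anticommute.
      refine (hproj _ (hself i)).mul_eq_zero_of_anticommute ?_
      have h := hproj (Pi.single i 1 + Pi.single j 1)
        ((hself i).add (hself j) <| by
          ext k; by_cases h : k = i <;> simp [Pi.single_apply, h, hij])
      have hadd : F (σ (Matrix.diagonal (Pi.single i 1 + Pi.single j 1))) = e i + e j := by
        simp only [he, ← map_add, Matrix.diagonal_add]
        rfl
      rw [hadd] at h
      exact (IsIdempotentElem.add_iff (hproj _ (hself i)) (hproj _ (hself j))).1 h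
  have hA' : A = σ (Matrix.diagonal (RCLike.ofReal ∘ hA.eigenvalues)) := hA.spectral_theorem
  rw [hA', ← map_mul, Matrix.diagonal_mul_diagonal, hsum, hsum,
    map_mul_self_sum_of_idempotent hidem]

/-- Polarization of `f (a * a) = f a * f a`. -/
lemma map_mul_add_mul_of_map_mul_self {A B : Type*} [Ring A] [Ring B] (f : A →+ B)
    (S : AddSubgroup A) (h : ∀ a ∈ S, f (a * a) = f a * f a) {a b : A} (ha : a ∈ S) (hb : b ∈ S) :
    f (a * b + b * a) = f a * f b + f b * f a := by
  have h1 := h (a + b) (S.add_mem ha hb)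
  simp only [map_add, add_mul, mul_add, h a ha, h b hb] at h1 ⊢
  have h2 := congrArg (fun z => z - f a * f a - f b * f b) h1
  convert h2 using 1 <;> abel

lemma map_mul_self_of_isSelfAdjoint {A B : Type*} [Ring A] [StarRing A] [Algebra ℂ A]
    [StarModule ℂ A] [Ring B] [Algebra ℂ B] (f : A →ₗ[ℂ] B)
    (h : ∀ a, IsSelfAdjoint a → f (a * a) = f a * f a)
    (a : A) : f (a * a) = f a * f a := by
  have h1 := map_mul_add_mul_of_map_mul_self f.toAddMonoidHom (selfAdjoint A) h (ℜ a).2 (ℑ a).2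
  simp only [LinearMap.toAddMonoidHom_coe] at h1
  have h2 : a * a = (ℜ a : A) * ℜ a - (ℑ a : A) * ℑ a +
      Complex.I • ((ℜ a : A) * ℑ a + (ℑ a : A) * ℜ a) := by
    conv_lhs => rw [← realPart_add_I_smul_imaginaryPart a]
    simp only [add_mul, mul_add, smul_mul_assoc, mul_smul_comm, smul_smul,
      Complex.I_mul_I, smul_add, neg_smul, one_smul]
    abel
  rw [h2, map_add, map_sub, map_smul, h1, h _ (ℜ a).2, h _ (ℑ a).2]
  conv_rhs => rw [← realPart_add_I_smul_imaginaryPart a]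
  simp only [map_add, map_smul, add_mul, mul_add, smul_mul_assoc, mul_smul_comm, smul_smul,
      Complex.I_mul_I, smul_add, neg_smul, one_smul]
  abel

lemma jordanMatrixUnits_of_map_mul_self
    (hF : ∀ M, F (M * M) = F M * F M) (hs : ∀ M, F (star M) = star (F M)) :
    JordanMatrixUnits fun i j => F (Matrix.single i j 1) where
  jordan i j k l := by
    have h := map_mul_add_mul_of_map_mul_self F.toAddMonoidHom ⊤ (fun a _ => hF a)
      (AddSubgroup.mem_top (Matrix.single i j (1 : ℂ))) (AddSubgroup.mem_top (Matrix.single k l 1))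
    simp only [LinearMap.toAddMonoidHom_coe] at h
    rw [← h, map_add]
    congr 1
    · split_ifs with hjk
      · subst hjk; simp
      · rw [Matrix.single_mul_single_of_ne _ _ _ _ hjk, map_zero]
    · split_ifs with hjk
      · subst hjk; simp
      · rw [Matrix.single_mul_single_of_ne _ _ _ _ hjk, map_zero]
  star_eq i j := by
    rw [← hs, Matrix.star_eq_conjTranspose, Matrix.conjTranspose_single, star_one]
end Jordan

/-! ### Operational maps are real-linear and preserve projections -/

namespace HamiltonianEncoding
variable {n m : ℕ} {E : Herm n → Herm m}

/-- The spectrum of `E 0` is `{0}`, which forces `E 0 = 0`; convex-linearity then gives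
linearity. -/
lemma IsOperational.isLinearMap (hE : IsOperational E) (hn : n ≠ 0) : IsLinearMap ℝ E := by
  have : NeZero n := ⟨hn⟩
  refine map_linear_of_map_convexCombination ?_ fun A B p hp => (hE A B p hp).2.2
  have h := (hE 0 0 0 (by norm_num)).2.1
  have h2 : (E 0 : Mat m) = ((0 : ℝ) : ℂ) • 1 :=
    Matrix.IsHermitian.eq_smul_one (E 0).2 (by simp [h])
  exact Subtype.ext (by simpa using h2)

lemma IsOperational.map_one (hE : IsOperational E) (hn : n ≠ 0) : E 1 = 1 := by
  have : NeZero n := ⟨hn⟩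
  have h := (hE 1 1 0 (by norm_num)).2.1
  have h2 : (E 1 : Mat m) = ((1 : ℝ) : ℂ) • 1 :=
    Matrix.IsHermitian.eq_smul_one (E 1).2 (by simp [h])
  exact Subtype.ext (by simpa using h2)

lemma IsOperational.isStarProjection (hE : IsOperational E) {P : Herm n}
    (hP : IsStarProjection (P : Mat n)) : IsStarProjection (E P : Mat m) := by
  rw [isStarProjection_iff_spectrum_subset_and_isSelfAdjoint] at hP ⊢
  refine ⟨?_, (E P).2⟩
  have h := (hE P P 0 (by norm_num)).2.1
  intro x hx
  refine hP.1 ?_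
  rw [← spectrum.algebraMap_mem_iff ℂ] at hx ⊢
  rwa [← h]

end HamiltonianEncoding

/-! ### Canonical forms and real star homomorphisms -/

namespace HamiltonianEncoding
variable {n m : ℕ}

lemma copies_one (p : ℕ) : copies p (1 : Mat n) = 1 := by
  have h : (Matrix.blockDiagonal fun _ : Fin p => (1 : Mat n)) = 1 := Matrix.blockDiagonal_one
  rw [copies, h, ← Matrix.coe_reindexRingEquiv, map_one]

lemma copies_conjTranspose (p : ℕ) (M : Mat n) : copies p Mᴴ = (copies p M)ᴴ := by
  rw [copies, copies, Matrix.conjTranspose_reindex, Matrix.blockDiagonal_conjTranspose]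

lemma copies_add (p : ℕ) (M N : Mat n) : copies p (M + N) = copies p M + copies p N := by
  have h := Matrix.blockDiagonal_add (fun _ : Fin p => M) fun _ => N
  simp only [copies]
  rw [← Matrix.coe_reindexAddEquiv, ← map_add, ← h]
  rfl

lemma copies_mul (p : ℕ) (M N : Mat n) : copies p (M * N) = copies p M * copies p N := by
  simp only [copies]
  rw [Matrix.blockDiagonal_mul, ← Matrix.coe_reindexRingEquiv, map_mul]

lemma copies_smul (p : ℕ) (x : ℝ) (M : Mat n) : copies p (x • M) = x • copies p M := by
  have h := Matrix.blockDiagonal_smul x (fun _ : Fin p => M)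
  simp only [copies]
  exact congrArg _ h

lemma conjMat_one : conjMat (1 : Mat n) = 1 := by simp [conjMat]
lemma conjMat_conjTranspose (M : Mat n) : conjMat Mᴴ = (conjMat M)ᴴ := by ext; simp [conjMat]
lemma conjMat_add (M N : Mat n) : conjMat (M + N) = conjMat M + conjMat N := by ext; simp [conjMat]
lemma conjMat_mul (M N : Mat n) : conjMat (M * N) = conjMat M * conjMat N := Matrix.map_mul
lemma conjMat_smul (x : ℝ) (M : Mat n) : conjMat (x • M) = x • conjMat M := by ext; simp [conjMat]

lemma HasCanonicalForm.isRealStarHom {E' : Mat n → Mat m} (h : HasCanonicalForm E') :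
    IsRealStarHom E' := by
  obtain ⟨p, q, rfl, U, hU, hE⟩ := h
  have hU1 : U * Uᴴ = 1 := Matrix.mem_unitaryGroup_iff.1 hU
  have hU2 : Uᴴ * U = 1 := Matrix.mem_unitaryGroup_iff'.1 hU
  simp only [directSum, finCongr_refl, Matrix.reindex_refl_refl,
    ← Matrix.coe_reindexRingEquiv] at hE
  set R := Matrix.reindexRingEquiv ℂ (finSumFinEquiv (m := p * n) (n := q * n)) with hR
  refine ⟨?_, fun A => ?_, fun A B => ?_, fun A B => ?_, fun x A => ?_⟩
  · simp [hE, copies_one, conjMat_one, hU1]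
  · simp [hE, hR, copies_conjTranspose, conjMat_conjTranspose, Matrix.mul_assoc,
      Matrix.fromBlocks_conjTranspose]
  · rw [hE, hE, hE, ← Matrix.add_mul, ← Matrix.mul_add, ← map_add,
      Matrix.fromBlocks_add, copies_add, conjMat_add, copies_add, add_zero, add_zero]
  · rw [hE, hE, hE]
    have h1 : ∀ X Y : Mat (p * n + q * n), U * X * Uᴴ * (U * Y * Uᴴ) = U * (X * Y) * Uᴴ := by
      intro X Y
      calc _ = U * X * (Uᴴ * U) * Y * Uᴴ := by noncomm_ring
        _ = _ := by rw [hU2]; noncomm_ring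
    rw [h1, ← map_mul, Matrix.fromBlocks_multiply]
    simp [copies_mul, conjMat_mul]
  · rw [hE, hE, copies_smul, conjMat_smul, copies_smul, ← Matrix.smul_mul, ← Matrix.mul_smul]
    congr 2
    ext i j
    simp only [hR, Matrix.coe_reindexRingEquiv, Matrix.reindex_apply, Matrix.submatrix_apply,
      Matrix.smul_apply]
    rcases finSumFinEquiv.symm i <;> rcases finSumFinEquiv.symm j <;> simp

/-- The ring homomorphism underlying a real star homomorphism. -/
def IsRealStarHom.toRingHom {E' : Mat n → Mat m} (h : IsRealStarHom E') : Mat n →+* Mat m where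
  toFun := E'
  map_one' := h.1
  map_mul' := h.2.2.2.1
  map_add' := h.2.2.1
  map_zero' := by simpa using h.2.2.2.2 0 0

/-- For `n ≥ 2` the Hermitian matrices generate all matrices as a ring. (For `n = 1` they are the
real numbers, and complex conjugation is an obstruction.) -/
lemma subring_eq_top_of_selfAdjoint_le (hn : 2 ≤ n) {S : Subring (Mat n)}
    (hS : ∀ H : Herm n, (H : Mat n) ∈ S) : S = ⊤ := by
  have hI : ∀ k : Fin n, Matrix.single k k Complex.I ∈ S := fun k => by
    have : Nontrivial (Fin n) := Fin.nontrivial_iff_two_le.2 hn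
    obtain ⟨i, hi⟩ := exists_ne k
    -- With the Pauli matrices `X` and `-Y` on the indices `i, k`, the product of `X`, `-Y` and
    -- the matrix unit at `(k, k)` is `I` times that matrix unit.
    have hX : Matrix.single i k (1 : ℂ) + Matrix.single k i 1 ∈ selfAdjoint (Mat n) := by
      rw [selfAdjoint.mem_iff, Matrix.star_eq_conjTranspose]
      simp [add_comm]
    have hY : Matrix.single i k Complex.I - Matrix.single k i Complex.I ∈ selfAdjoint (Mat n) := by
      rw [selfAdjoint.mem_iff, Matrix.star_eq_conjTranspose]
      simp only [Matrix.conjTranspose_sub, Matrix.conjTranspose_single, RCLike.star_def,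
        Complex.conj_I, ← Matrix.single_neg]
      abel
    have hZ : Matrix.single k k (1 : ℂ) ∈ selfAdjoint (Mat n) := by
      rw [selfAdjoint.mem_iff, Matrix.star_eq_conjTranspose]
      simp
    have h := S.mul_mem (S.mul_mem (hS ⟨_, hX⟩) (hS ⟨_, hY⟩)) (hS ⟨_, hZ⟩)
    simpa [add_mul, mul_sub, sub_mul, hi, hi.symm] using h
  have hI1 : Complex.I • (1 : Mat n) ∈ S := by
    have h : Complex.I • (1 : Mat n) = ∑ k, Matrix.single k k Complex.I := by
      rw [Matrix.smul_one_eq_diagonal, Matrix.sum_single_eq_diagonal]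
    rw [h]
    exact S.sum_mem fun k _ => hI k
  refine eq_top_iff.2 fun M _ => ?_
  rw [← realPart_add_I_smul_imaginaryPart M]
  have h := S.mul_mem hI1 (hS (ℑ M))
  rw [smul_mul_assoc, one_mul] at h
  exact S.add_mem (hS _) h

lemma IsRealStarHom.eq_of_extends (hn : 2 ≤ n) {E : Herm n → Herm m} {E₁ E₂ : Mat n → Mat m}
    (h₁ : IsRealStarHom E₁) (h₂ : IsRealStarHom E₂) (e₁ : Extends E₁ E) (e₂ : Extends E₂ E) :
    E₁ = E₂ := by
  have h := subring_eq_top_of_selfAdjoint_le hn (S := h₁.toRingHom.eqLocus h₂.toRingHom)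
    fun H => (e₁ H).trans (e₂ H).symm
  funext M
  exact h.ge (Subring.mem_top M)

lemma isUnit_map_iff_of_injective {R S : Type*} [Ring R] [IsArtinianRing R] [Ring S] {f : R →+* S}
    (hf : Function.Injective f) (a : R) : IsUnit (f a) ↔ IsUnit a := by
  refine ⟨fun h => IsArtinianRing.isUnit_iff_isRegular.2 ⟨fun x y hxy => ?_, fun x y hxy => ?_⟩,
    fun h => h.map f⟩
  · refine hf (h.mul_left_cancel ?_)
    simpa using congrArg f hxy
  · refine hf (h.mul_right_cancel ?_)
    simpa using congrArg f hxy

lemma IsRealStarHom.spectrum_real_map {E' : Mat n → Mat m} (h : IsRealStarHom E') (hn : n ≠ 0)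
    (hm : m ≠ 0) (M : Mat n) : spectrum ℝ (E' M) = spectrum ℝ M := by
  have : NeZero n := ⟨hn⟩
  have : NeZero m := ⟨hm⟩
  have : IsArtinianRing (Mat n) := IsArtinianRing.of_finite ℂ _
  ext r
  have h1 : algebraMap ℝ (Mat m) r - E' M = h.toRingHom (algebraMap ℝ (Mat n) r - M) := by
    rw [map_sub, Algebra.algebraMap_eq_smul_one, Algebra.algebraMap_eq_smul_one]
    congr 1
    exact ((h.2.2.2.2 r 1).trans (by rw [h.1])).symm
  rw [spectrum.mem_iff, spectrum.mem_iff, h1, isUnit_map_iff_of_injective h.toRingHom.injective]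

lemma spectrum_complex_eq_image {M : Mat n} (hM : M.IsHermitian) :
    spectrum ℂ M = (fun r : ℝ => (r : ℂ)) '' spectrum ℝ M := by
  rw [hM.spectrum_eq_image_range, hM.spectrum_real_eq_range_eigenvalues]
  rfl

lemma IsRealStarHom.isOperational {E : Herm n → Herm m} {E' : Mat n → Mat m} (h : IsRealStarHom E')
    (he : Extends E' E) (hn : n ≠ 0) (hm : m ≠ 0) : IsOperational E := by
  refine fun A B p _ => ⟨(E A).2.symm, ?_, Subtype.ext ?_⟩
  · rw [spectrum_complex_eq_image (E A).2, spectrum_complex_eq_image A.2, ← he,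
      h.spectrum_real_map hn hm]
  · rw [← he]
    simp [h.2.2.1, h.2.2.2.2, he A, he B]

end HamiltonianEncoding

/-! ### Isometries from columns of matrix units -/

/-- An orthonormal basis of the range of a projection, as the columns of `V`. -/
lemma exists_isometry_of_isStarProjection {m : ℕ} {P : Matrix (Fin m) (Fin m) ℂ}
    (hP : IsStarProjection P) :
    ∃ (p : ℕ) (V : Matrix (Fin m) (Fin p) ℂ), Vᴴ * V = 1 ∧ V * Vᴴ = P := by
  have hH : P.IsHermitian := hP.2
  have hspec := (isStarProjection_iff_spectrum_subset_and_isSelfAdjoint.1 hP).1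
  have h01 : ∀ i, hH.eigenvalues i = 0 ∨ hH.eigenvalues i = 1 := fun i =>
    hspec (hH.eigenvalues_mem_spectrum_real i)
  set U : Matrix (Fin m) (Fin m) ℂ := (hH.eigenvectorUnitary : Matrix (Fin m) (Fin m) ℂ) with hU
  have hUU : Uᴴ * U = 1 := Matrix.mem_unitaryGroup_iff'.1 hH.eigenvectorUnitary.2
  let e := (Fintype.equivFin {i // hH.eigenvalues i = 1}).symm
  refine ⟨_, U.submatrix id (fun k => (e k : Fin m)), ?_, ?_⟩
  · rw [Matrix.conjTranspose_submatrix, ← Matrix.submatrix_mul _ _ _ _ _ Function.bijective_id, hUU]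
    ext i j
    simp [Matrix.one_apply, Subtype.ext_iff.symm]
  · have h := hH.spectral_theorem
    rw [Unitary.conjStarAlgAut_apply] at h
    change P = U * Matrix.diagonal (RCLike.ofReal ∘ hH.eigenvalues) * Uᴴ at h
    refine Eq.trans ?_ h.symm
    ext a b
    have h2 : ∀ i, (U * (Matrix.diagonal (RCLike.ofReal ∘ hH.eigenvalues) : Matrix _ _ ℂ)) a i *
        Uᴴ i b = if hH.eigenvalues i = 1 then U a i * Uᴴ i b else 0 := fun i => by
      rw [Matrix.mul_diagonal]
      rcases h01 i with hi | hi <;> simp [hi]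
    rw [Matrix.mul_apply, Matrix.mul_apply, Finset.sum_congr rfl fun i _ => h2 i,
      ← Finset.sum_filter, Finset.sum_subtype (p := fun i => hH.eigenvalues i = 1) _ (by simp)]
    exact e.sum_comp fun i => U a i * Uᴴ i b

/-- The blocks `B i`, written side by side: the column with index `(i, k)` is the `k`-th column of
`B i`. -/
def Matrix.blockColumn {ι κ l α : Type*} (B : ι → Matrix l κ α) : Matrix l (ι × κ) α :=
  Matrix.of fun s ik => B ik.1 s ik.2

lemma Matrix.conjTranspose_blockColumn_mul_apply {ι κ κ' l : Type*} [Fintype l]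
    (B : ι → Matrix l κ ℂ) (C : ι → Matrix l κ' ℂ) (i j : ι) (k : κ) (k' : κ') :
    ((Matrix.blockColumn B)ᴴ * Matrix.blockColumn C) (i, k) (j, k') = ((B i)ᴴ * C j) k k' := rfl

lemma Matrix.blockColumn_mul_blockDiagonal_mul {ι κ l : Type*} [Fintype ι] [Fintype κ]
    [DecidableEq κ] (B : ι → Matrix l κ ℂ) (M : Matrix ι ι ℂ) :
    Matrix.blockColumn B * (Matrix.blockDiagonal fun _ : κ => M) * (Matrix.blockColumn B)ᴴ =
      ∑ i, ∑ j, M i j • (B i * (B j)ᴴ) := by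
  ext s t
  simp only [Matrix.mul_apply, Matrix.sum_apply, Matrix.smul_apply, Fintype.sum_prod_type,
    Matrix.blockDiagonal_apply, Matrix.blockColumn, Matrix.of_apply, Matrix.conjTranspose_apply,
    mul_ite, mul_zero, Finset.sum_ite_eq', Finset.mem_univ, if_true, smul_eq_mul,
    Finset.mul_sum, Finset.sum_mul]
  rw [Finset.sum_comm (s := Finset.univ (α := ι)) (t := Finset.univ (α := ι))]
  refine Finset.sum_congr rfl fun j _ => ?_
  rw [Finset.sum_comm]
  refine Finset.sum_congr rfl fun i _ => Finset.sum_congr rfl fun k _ => ?_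
  ring

namespace IsMatrixUnitColumn
variable {ι κ l : Type*} [Fintype l] [DecidableEq ι] [DecidableEq l] [DecidableEq κ] [Fintype κ]
  {o : ι} {a : ι → Matrix l l ℂ}

lemma isometry (ha : IsMatrixUnitColumn o a) {V : Matrix l κ ℂ}
    (hV : Vᴴ * V = 1) (hVP : V * Vᴴ = a o) :
    (Matrix.blockColumn fun i => a i * V)ᴴ * (Matrix.blockColumn fun i => a i * V) = 1 := by
  ext ⟨i, k⟩ ⟨j, k'⟩
  rw [Matrix.conjTranspose_blockColumn_mul_apply, Matrix.conjTranspose_mul, Matrix.mul_assoc,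
    ← Matrix.mul_assoc (a i)ᴴ, ← Matrix.star_eq_conjTranspose (a i), ha.star_mul_eq]
  split_ifs with h
  · subst h
    rw [← hVP, Matrix.mul_assoc V, hV, Matrix.mul_one, hV]
    simp [Matrix.one_apply]
  · simp [h]

lemma mul_blockDiagonal_mul [Fintype ι] (ha : IsMatrixUnitColumn o a) {V : Matrix l κ ℂ}
    (hVP : V * Vᴴ = a o) (M : Matrix ι ι ℂ) :
    (Matrix.blockColumn fun i => a i * V) * (Matrix.blockDiagonal fun _ : κ => M) *
        (Matrix.blockColumn fun i => a i * V)ᴴ = ∑ i, ∑ j, M i j • (a i * star (a j)) := by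
  rw [Matrix.blockColumn_mul_blockDiagonal_mul]
  refine Finset.sum_congr rfl fun i _ => Finset.sum_congr rfl fun j _ => ?_
  nth_rewrite 2 [← ha.mul_base i]
  rw [← hVP, Matrix.conjTranspose_mul, Matrix.star_eq_conjTranspose]
  simp only [Matrix.mul_assoc]

lemma isStarProjection (ha : IsMatrixUnitColumn o a) : IsStarProjection (a o) := by
  have h : star (a o) * a o = a o := by simpa using ha.star_mul_eq o o
  refine ⟨ha.mul_base o, ?_⟩
  have h' := congrArg star h
  rwa [star_mul, star_star, h, eq_comm] at h'

end IsMatrixUnitColumn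

/-! ### The canonical form of an operational map -/

namespace HamiltonianEncoding
variable {n m : ℕ}

/-- Two isometries whose ranges are orthogonal and span the space are the two block columns of the
unitary in a canonical form. -/
lemma hasCanonicalForm_of_isometries {p q : ℕ} {W : Matrix (Fin m) (Fin n × Fin p) ℂ}
    {X : Matrix (Fin m) (Fin n × Fin q) ℂ} (hW : Wᴴ * W = 1) (hX : Xᴴ * X = 1) (hWX : Wᴴ * X = 0)
    (hsum : W * Wᴴ + X * Xᴴ = 1) :
    HasCanonicalForm fun M : Mat n => W * (Matrix.blockDiagonal fun _ : Fin p => M) * Wᴴ +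
      X * (Matrix.blockDiagonal fun _ : Fin q => conjMat M) * Xᴴ := by
  set Y := Matrix.fromCols W X with hY
  have hXW : Xᴴ * W = 0 := by simpa using congrArg Matrix.conjTranspose hWX
  have hY1 : Y * Yᴴ = 1 := by
    rw [hY, Matrix.conjTranspose_fromCols_eq_fromRows_conjTranspose, Matrix.fromCols_mul_fromRows,
      hsum]
  have hY2 : Yᴴ * Y = 1 := by
    rw [hY, Matrix.conjTranspose_fromCols_eq_fromRows_conjTranspose, Matrix.fromRows_mul_fromCols,
      hW, hX, hWX, hXW, Matrix.fromBlocks_one]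
  -- Both dimensions are the trace of an identity matrix, `Y * Yᴴ` and `Yᴴ * Y` respectively.
  have hcard : p * n + q * n = m := by
    have h := Matrix.trace_mul_comm Y Yᴴ
    rw [hY1, hY2, Matrix.trace_one, Matrix.trace_one] at h
    have h' : m = n * p + n * q := by
      have h2 := Nat.cast_injective h
      simpa using h2
    rw [h', mul_comm p, mul_comm q]
  let e (p : ℕ) : Fin n × Fin p ≃ Fin (p * n) := (Equiv.prodComm _ _).trans finProdFinEquiv
  let f : (Fin n × Fin p) ⊕ (Fin n × Fin q) ≃ Fin m :=
    ((Equiv.sumCongr (e p) (e q)).trans finSumFinEquiv).trans (finCongr hcard)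
  have hf : ∀ M : Mat n, Matrix.reindex (finCongr hcard) (finCongr hcard)
      (directSum (copies p M) (copies q (conjMat M))) = Matrix.reindex f f (Matrix.fromBlocks
        (Matrix.blockDiagonal fun _ : Fin p => M) 0 0
        (Matrix.blockDiagonal fun _ : Fin q => conjMat M)) := by
    intro M
    ext s t
    obtain ⟨s, rfl⟩ := f.surjective s
    obtain ⟨t, rfl⟩ := f.surjective t
    rcases s with s | s <;> rcases t with t | t <;>
      simp [f, e, directSum, copies]
  refine ⟨p, q, hcard, Y.submatrix id f.symm, ?_, fun M => ?_⟩
  · rw [Matrix.mem_unitaryGroup_iff, Matrix.star_eq_conjTranspose, Matrix.conjTranspose_submatrix,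
      Matrix.submatrix_mul_equiv, hY1, Matrix.submatrix_id_id]
  · rw [hf, Matrix.reindex_apply, Matrix.conjTranspose_submatrix, Matrix.submatrix_mul_equiv,
      Matrix.submatrix_mul_equiv, Matrix.submatrix_id_id, hY,
      Matrix.conjTranspose_fromCols_eq_fromRows_conjTranspose, Matrix.fromCols_mul_fromBlocks,
      Matrix.fromCols_mul_fromRows]
    simp

lemma IsOperational.exists_hasCanonicalForm {E : Herm n → Herm m} (hE : IsOperational E)
    (hn : 2 ≤ n) : ∃ E' : Mat n → Mat m, Extends E' E ∧ HasCanonicalForm E' := by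
  have hn0 : n ≠ 0 := by omega
  have : NeZero n := ⟨hn0⟩
  have : Nontrivial (Fin n) := Fin.nontrivial_iff_two_le.2 hn
  have : IsAddTorsionFree (Mat m) := .of_module_rat _
  set F : Mat n →ₗ[ℂ] Mat m := complexify (hE.isLinearMap hn0).mk' with hF
  have hFE : ∀ H : Herm n, F H = E H := complexify_coe _
  have hFsq : ∀ M, F (M * M) = F M * F M :=
    map_mul_self_of_isSelfAdjoint F fun A hA => map_mul_self_of_isHermitian
      (fun P hP => by
        have h := (hE.isStarProjection (P := ⟨P, hP.2⟩) hP).1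
        rwa [← hFE] at h) hA
  set x : Fin n → Fin n → Mat m := fun i j => F (Matrix.single i j 1) with hxdef
  have hx : JordanMatrixUnits x := jordanMatrixUnits_of_map_mul_self hFsq (complexify_star _)
  obtain ⟨k, hk⟩ := exists_ne (0 : Fin n)
  set a := JordanMatrixUnits.column x 0 k
  set b := JordanMatrixUnits.column (fun i j => x j i) 0 k
  have ha : IsMatrixUnitColumn 0 a := hx.isMatrixUnitColumn hk
  have hb : IsMatrixUnitColumn 0 b := hx.flip.isMatrixUnitColumn hk
  have hab : ∀ i j, x i j = a i * star (a j) + b j * star (b i) := hx.eq_column_add_flip_column hk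
  obtain ⟨p, V, hV, hVa⟩ := exists_isometry_of_isStarProjection ha.isStarProjection
  obtain ⟨q, W, hW, hWb⟩ := exists_isometry_of_isStarProjection hb.isStarProjection
  have hFx : ∀ M : Mat n, F M = ∑ i, ∑ j, M i j • (a i * star (a j)) +
      ∑ i, ∑ j, M j i • (b i * star (b j)) := fun M => by
    conv_lhs => rw [Matrix.matrix_eq_sum_single M]
    rw [Finset.sum_comm (f := fun i j => M j i • (b i * star (b j)))]
    simp only [map_sum, ← Finset.sum_add_distrib, ← smul_add, ← hab]
    refine Finset.sum_congr rfl fun i _ => Finset.sum_congr rfl fun j _ => ?_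
    rw [hxdef, ← map_smul, Matrix.smul_single, smul_eq_mul, mul_one]
  have hF1 : F 1 = 1 := by
    have h := hFE 1
    rwa [hE.map_one hn0] at h
  -- The anti-homomorphic part of `F M` is built from the transpose of `M`, which is the entrywise
  -- conjugate of `M` when `M` is Hermitian.
  refine ⟨_, fun H => ?_, hasCanonicalForm_of_isometries (ha.isometry hV hVa)
    (hb.isometry hW hWb) ?_ ?_⟩
  · rw [← hFE, hFx, ha.mul_blockDiagonal_mul hVa, hb.mul_blockDiagonal_mul hWb]
    have hH : ∀ i j, conjMat (H : Mat n) i j = (H : Mat n) j i := fun i j =>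
      Matrix.IsHermitian.apply H.2 j i
    simp only [hH]
  · ext ⟨i, r⟩ ⟨j, s⟩
    rw [Matrix.conjTranspose_blockColumn_mul_apply, Matrix.conjTranspose_mul, Matrix.mul_assoc,
      ← Matrix.mul_assoc (a i)ᴴ, ← Matrix.star_eq_conjTranspose (a i),
      hx.star_column_mul_flip_column hk, Matrix.zero_mul, Matrix.mul_zero]
    rfl
  · have h1 := ha.mul_blockDiagonal_mul hVa 1
    have h2 := hb.mul_blockDiagonal_mul hWb 1
    have h3 := hFx 1
    have hbd : ∀ p : ℕ, (Matrix.blockDiagonal fun _ : Fin p => (1 : Mat n)) = 1 := fun _ =>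
      Matrix.blockDiagonal_one
    rw [hbd, Matrix.mul_one] at h1 h2
    rw [h1, h2, ← hF1, h3]
    simp only [Matrix.one_apply, eq_comm]

end HamiltonianEncoding

theorem mainTheorem2 (n m : ℕ) (hn : 2 ≤ n) (hm : 1 ≤ m)
    (E : HamiltonianEncoding.Herm n → HamiltonianEncoding.Herm m) :
    List.TFAE [
      HamiltonianEncoding.IsOperational E,
      ∃! E' : HamiltonianEncoding.Mat n → HamiltonianEncoding.Mat m,
        HamiltonianEncoding.Extends E' E ∧ HamiltonianEncoding.IsRealStarHom E',
      ∃! E' : HamiltonianEncoding.Mat n → HamiltonianEncoding.Mat m,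
        HamiltonianEncoding.Extends E' E ∧ HamiltonianEncoding.HasCanonicalForm E'] := by
  have hn0 : n ≠ 0 := by omega
  have hm0 : m ≠ 0 := by omega
  tfae_have 1 → 3 := fun hE => by
    obtain ⟨E', he, hc⟩ := hE.exists_hasCanonicalForm hn
    exact ⟨E', ⟨he, hc⟩, fun E'' h =>
      h.2.isRealStarHom.eq_of_extends hn hc.isRealStarHom h.1 he⟩
  tfae_have 3 → 2 := fun ⟨E', ⟨he, hc⟩, _⟩ => ⟨E', ⟨he, hc.isRealStarHom⟩, fun E'' h =>
    h.2.eq_of_extends hn hc.isRealStarHom h.1 he⟩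
  tfae_have 2 → 1 := fun ⟨_, ⟨he, hs⟩, _⟩ => hs.isOperational he hn0 hm0
  tfae_finish
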